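/- Let $\mathbb{R}^2_+=\{\mathbf{x}\in\mathbb{R}^2: x_2>0\}$, let $\widetilde B_R=\{\mathbf{x}\in\mathbb{R}^2_+:|\mathbf{x}|<R\}$, let $$\bar{x}=\big(e+|\mathbf{x}|^2\big)^{1/2}\log^2\big(e+|\mathbf{x}|^2\big),$$ and let $D^1_0(\mathbb{R}^2_+)$ be the space of vector fields $\mathbf{v}:\mathbb{R}^2_+\to\mathbb{R}^2$ that are integrable on bounded subsets of $\mathbb{R}^2_+$, have a weak gradient $\nabla\mathbf{v}\in L^2(\mathbb{R}^2_+)$, and have zero trace on $\partial\mathbb{R}^2_+$. For all positive constants $M_1,M_2,M_3$ there exists a constant $C>0$, depending only on $M_1,M_2,M_3$, such that the following holds. Let $\alpha\in(1,\infty)$, $\zeta=\frac{4(2\alpha+1)}{\alpha-1}$, $\eta_*\ge 1$, and let $\varrho\ge 0$ be a function in $L^1(\mathbb{R}^2_+)\cap L^\zeta(\mathbb{R}^2_+)$ with $$M_2\le\int_{\widetilde B_{\eta_*}}\varrho\,\mathrm{d}\mathbf{x}\le\|\varrho\|_{L^1(\mathbb{R}^2_+)}=M_1,\qquad \|\varrho\|_{L^\zeta(\mathbb{R}^2_+)}\le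 M_3,\qquad \bar{x}^\alpha\varrho\in L^1(\mathbb{R}^2_+).$$ Then for every $\mathbf{v}\in D^1_0(\mathbb{R}^2_+)$ with $\sqrt{\varrho}\,\mathbf{v}\in L^2(\mathbb{R}^2_+)$, $$\|\varrho\mathbf{v}\|_{L^4(\mathbb{R}^2_+)}^4\le C\,\eta_*^8\,\big(1+\|\bar{x}^\alpha\varrho\|_{L^1(\mathbb{R}^2_+)}\big)\big(\|\sqrt{\varrho}\,\mathbf{v}\|_{L^2(\mathbb{R}^2_+)}^4+\|\nabla\mathbf{v}\|_{L^2(\mathbb{R}^2_+)}^4\big).$$ -/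

import Mathlib

open MeasureTheory
open scoped ContDiff ENNReal

noncomputable section

/-- The Euclidean plane. -/
abbrev Plane : Type := EuclideanSpace ℝ (Fin 2)

/-- `2 × 2` real matrices with the Frobenius norm; the entry `(i, j)` of a gradient is `∂_j v_i`. -/
abbrev Mat22 : Type := EuclideanSpace ℝ (Fin 2 × Fin 2)

/-- The open upper half-plane `{x | x₂ > 0}`. -/
def halfPlane : Set Plane := {x | 0 < x 1}

/-- Lebesgue measure on the half-plane. -/
def halfVol : Measure Plane := volume.restrict halfPlane

/-- The half-ball `B_R ∩ ℝ²₊`, with `B_R` the open ball about the origin. -/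
def halfBall (R : ℝ) : Set Plane := Metric.ball 0 R ∩ halfPlane

/-- The weight `x̄ = (e + |x|²)^{1/2} log²(e + |x|²)`. -/
def xbar (x : Plane) : ℝ :=
  Real.sqrt (Real.exp 1 + ‖x‖ ^ 2) * Real.log (Real.exp 1 + ‖x‖ ^ 2) ^ 2

/-- The partial derivative `∂_j φ` of a smooth function. -/
def pderiv (j : Fin 2) (φ : Plane → ℝ) (x : Plane) : ℝ :=
  fderiv ℝ φ x (EuclideanSpace.single j 1)

/-- `Dv` is the weak gradient of `v` in the open half-plane. -/
structure IsWeakGradient (v : Plane → Plane) (Dv : Plane → Mat22) : Prop where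
  locInt : LocallyIntegrableOn v halfPlane
  locInt_grad : LocallyIntegrableOn Dv halfPlane
  integral_eq : ∀ φ : Plane → ℝ, ContDiff ℝ ∞ φ → HasCompactSupport φ →
    tsupport φ ⊆ halfPlane → ∀ i j : Fin 2,
      ∫ x, v x i * pderiv j φ x ∂halfVol = -∫ x, Dv x (i, j) * φ x ∂halfVol

/-- `g` is the trace on `∂ℝ²₊ = ℝ × {0}` of `v`, a function which together with its weak gradient
`Dv` is integrable on bounded parts of the half-plane. The trace is determined by Green's formula
`∫ v_i ∂_j φ + ∫ (∂_j v_i) φ = ∫_{∂ℝ²₊} g_i φ ν_j`, with outer normal `ν = (0, -1)`, for all test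
functions `φ` on the whole plane (so `φ` need not vanish on the boundary). -/
structure HasTrace (v : Plane → Plane) (Dv : Plane → Mat22) (g : ℝ → Plane) : Prop where
  weakGradient : IsWeakGradient v Dv
  locInt : LocallyIntegrable v halfVol
  locInt_grad : LocallyIntegrable Dv halfVol
  locInt_trace : LocallyIntegrable g
  green : ∀ φ : Plane → ℝ, ContDiff ℝ ∞ φ → HasCompactSupport φ → ∀ i j : Fin 2,
    ∫ x, v x i * pderiv j φ x ∂halfVol + ∫ x, Dv x (i, j) * φ x ∂halfVol
      = ∫ s : ℝ, g s i * φ !₂[s, 0] * (!₂[0, -1] : Plane) j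

/-- `v` belongs to `D¹₀(ℝ²₊)` and `Dv` is its weak gradient: `v ∈ L¹_loc`, `∇v ∈ L²`, and the trace
of `v` on the boundary vanishes. -/
structure IsD10 (v : Plane → Plane) (Dv : Plane → Mat22) : Prop where
  weakGradient : IsWeakGradient v Dv
  memLp_grad : MemLp Dv 2 halfVol
  trace_eq_zero : HasTrace v Dv 0

end

open Filter Topology
open scoped Convolution

/-! Write `y = x 1` for the distance to the boundary. Vanishing trace makes Hardy's inequality
available, and it improves to the scale-invariant bound `∫ |v|^16 / y² ≤ C ‖∇v‖₂^16`. The theorem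
then follows from Hölder's inequality with exponents `a + b + 1/4 = 1`: the factor `(|v|^16 /
y²)^(1/4) = |v|^4 / y^(1/2)` loses `y^(1/2)`, which the weight repays because `y ≤ x̄` and `α a ≥
1/2`, while `a + ζ b = 4` produces the power `ϱ^4`. The gradient alone controls the left side; `η ^
8 ≥ 1` and the term in `√ϱ v` only enlarge the right side.

The bound with weight `y⁻²` (`exists_lintegral_norm_pow_div_le`) is proved by induction on the
power. `hardy_halfPlane` is the case of squares. In `exists_lintegral_pow_div_le_step` the planar
Sobolev inequality, from gradient in `L¹` to `L²`, is applied to a cutoff of `u^(m+1) / y`: its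
square is the next weighted power, and its gradient is controlled by earlier ones and the Dirichlet
integral.

This is done for `C¹` functions vanishing near the boundary. By Green's formula with zero trace, the
extension of `v` by zero has a weak gradient in `L²` of the whole plane; mollifying it, shifting it
into the half-plane and applying Fatou's lemma gives the general case. -/

/-! ### Smooth cutoffs. -/

lemma exists_abs_deriv_smoothTransition_le :
    ∃ K : ℝ, 0 ≤ K ∧ ∀ t, |deriv Real.smoothTransition t| ≤ K := by
  have hc : Continuous (deriv Real.smoothTransition) :=
    (Real.smoothTransition.contDiff (n := 1)).continuous_deriv (by norm_num)
  obtain ⟨K, hK⟩ := (isCompact_Icc (a := (-1 : ℝ)) (b := 2)).exists_bound_of_continuousOn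
    hc.continuousOn
  refine ⟨K, (norm_nonneg _).trans (hK 0 (by norm_num)), fun t => ?_⟩
  by_cases ht : t ∈ Set.Icc (-1 : ℝ) 2
  · exact hK t ht
  have h0 : deriv Real.smoothTransition t = 0 := by
    rcases not_and_or.1 ht with h | h
    · have : Real.smoothTransition =ᶠ[𝓝 t] fun _ => 0 := by
        filter_upwards [eventually_lt_nhds (show t < 0 by linarith)] with s hs
        exact Real.smoothTransition.zero_of_nonpos hs.le
      simp [this.deriv_eq]
    · have : Real.smoothTransition =ᶠ[𝓝 t] fun _ => 1 := by
        filter_upwards [eventually_gt_nhds (show 1 < t by linarith)] with s hs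
        exact Real.smoothTransition.one_of_one_le hs.le
      simp [this.deriv_eq]
  rw [h0, abs_zero]
  exact (norm_nonneg _).trans (hK 0 (by norm_num))

lemma abs_coord_le_norm (x : Plane) (i : Fin 2) : |x i| ≤ ‖x‖ :=
  PiLp.norm_apply_le x i

lemma norm_coord_proj_le (i : Fin 2) : ‖(EuclideanSpace.proj i : Plane →L[ℝ] ℝ)‖ ≤ 1 :=
  ContinuousLinearMap.opNorm_le_bound _ zero_le_one fun x => by
    simpa using abs_coord_le_norm x i

/-- Smooth cutoffs at scale `R` whose gradient is controlled by the distance to the boundary and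
which decrease in the normal direction. -/
lemma exists_cutoff : ∃ K : ℝ, 0 ≤ K ∧ ∀ R : ℝ, 0 < R → ∃ χ : Plane → ℝ,
    ContDiff ℝ 1 χ ∧ HasCompactSupport χ ∧ (∀ x, 0 ≤ χ x) ∧ (∀ x, χ x ≤ 1) ∧
    (∀ x ∈ Metric.ball (0 : Plane) R, χ x = 1) ∧
    (∀ x : Plane, 0 < x 1 → ‖fderiv ℝ χ x‖ ≤ K / x 1) ∧
    (∀ x : Plane, 0 < x 1 → pderiv 1 χ x ≤ 0) := by
  obtain ⟨K, hK0, hK⟩ := exists_abs_deriv_smoothTransition_le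
  refine ⟨4 * K, by positivity, fun R hR => ?_⟩
  -- Using `‖x‖ ^ 2` keeps `χ` smooth at the origin. Where the gradient is nonzero, `‖x‖ ^ 2 ≤ 2 * R
  -- ^ 2`, so `x 1 * ‖∇χ‖ ≤ 2 K ‖x‖ ^ 2 / R ^ 2 ≤ 4 K`, independently of `R`.
  set χ : Plane → ℝ := fun x => Real.smoothTransition (2 - ‖x‖ ^ 2 / R ^ 2) with hχ
  have hR2 : 0 < R ^ 2 := by positivity
  have hout : ∀ x : Plane, 2 * R ^ 2 ≤ ‖x‖ ^ 2 → χ x = 0 := fun x hx => by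
    apply Real.smoothTransition.zero_of_nonpos
    rw [sub_nonpos, le_div_iff₀ hR2]; exact hx
  have hder : ∀ x : Plane, HasFDerivAt χ
      (deriv Real.smoothTransition (2 - ‖x‖ ^ 2 / R ^ 2) • (-((R ^ 2)⁻¹ • (2 • innerSL ℝ x : Plane →L[ℝ] ℝ)))) x := by
    intro x
    have h1 : HasFDerivAt (fun y : Plane => ‖y‖ ^ 2) (2 • innerSL ℝ x) x :=
      (hasStrictFDerivAt_norm_sq x).hasFDerivAt
    have h2 : HasFDerivAt (fun y : Plane => 2 - ‖y‖ ^ 2 / R ^ 2)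
        (-((R ^ 2)⁻¹ • (2 • innerSL ℝ x : Plane →L[ℝ] ℝ))) x := by
      simp_rw [div_eq_inv_mul]
      exact (h1.const_mul _).const_sub 2
    have h3 : HasDerivAt Real.smoothTransition _ (2 - ‖x‖ ^ 2 / R ^ 2) :=
      (((Real.smoothTransition.contDiff (n := 1)).differentiable (by norm_num)) _).hasDerivAt
    exact h3.comp_hasFDerivAt x h2
  have hcd : ContDiff ℝ 1 χ :=
    (Real.smoothTransition.contDiff (n := 1)).comp
      (contDiff_const.sub ((contDiff_norm_sq ℝ).div_const _))
  refine ⟨χ, hcd, ?_, fun x => Real.smoothTransition.nonneg _, fun x =>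
    Real.smoothTransition.le_one _, ?_, ?_, ?_⟩
  · refine HasCompactSupport.intro (isCompact_closedBall (0 : Plane) (2 * R)) fun x hx => hout x ?_
    simp only [Metric.mem_closedBall, dist_zero_right, not_le] at hx
    nlinarith
  · intro x hx
    apply Real.smoothTransition.one_of_one_le
    have : ‖x‖ < R := by simpa using hx
    have h : ‖x‖ ^ 2 / R ^ 2 ≤ 1 := by
      rw [div_le_one hR2]; nlinarith [norm_nonneg x]
    linarith
  · intro x hx
    by_cases hxR : 2 * R ^ 2 < ‖x‖ ^ 2
    · have : χ =ᶠ[𝓝 x] fun _ => 0 := by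
        have ho : IsOpen {y : Plane | 2 * R ^ 2 < ‖y‖ ^ 2} :=
          isOpen_lt continuous_const (continuous_norm.pow 2)
        filter_upwards [ho.mem_nhds hxR] with y hy
        exact hout y (le_of_lt hy)
      rw [this.fderiv_eq]; simp; positivity
    · push Not at hxR
      rw [(hder x).fderiv, norm_smul, norm_neg, norm_smul, Real.norm_eq_abs, le_div_iff₀ hx]
      have h1 : ‖(2 • innerSL ℝ x : Plane →L[ℝ] ℝ)‖ ≤ 2 * ‖x‖ := by
        refine (norm_nsmul_le).trans ?_
        simp
      have h2 : x 1 ≤ ‖x‖ := (le_abs_self _).trans (abs_coord_le_norm x 1)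
      have h3 : ‖(R ^ 2)⁻¹‖ * ‖(2 • innerSL ℝ x : Plane →L[ℝ] ℝ)‖ * x 1 ≤ 4 := by
        rw [Real.norm_of_nonneg (by positivity), mul_assoc, inv_mul_le_iff₀ hR2]
        calc _ ≤ (2 * ‖x‖) * ‖x‖ := by gcongr
          _ ≤ _ := by nlinarith
      calc _ = |deriv Real.smoothTransition (2 - ‖x‖ ^ 2 / R ^ 2)| *
            (‖(R ^ 2)⁻¹‖ * ‖(2 • innerSL ℝ x : Plane →L[ℝ] ℝ)‖ * x 1) := by ring
        _ ≤ K * 4 := by gcongr; exact hK _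
        _ = 4 * K := by ring
  · intro x hx
    have hd : 0 ≤ deriv Real.smoothTransition (2 - ‖x‖ ^ 2 / R ^ 2) :=
      Real.smoothTransition.monotone.deriv_nonneg
    have : pderiv 1 χ x = -(deriv Real.smoothTransition (2 - ‖x‖ ^ 2 / R ^ 2) *
        ((R ^ 2)⁻¹ * (2 * x 1))) := by
      rw [pderiv, (hder x).fderiv]
      simp [EuclideanSpace.inner_single_right]
    rw [this, neg_nonpos]
    positivity

/-! ### Division by the distance to the boundary, and Hardy's inequality. -/

lemma hasFDerivAt_div_coord {h : Plane → ℝ} {x : Plane} (hh : DifferentiableAt ℝ h x)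
    (hx : x 1 ≠ 0) :
    HasFDerivAt (fun y : Plane => h y / y 1)
      ((x 1)⁻¹ • fderiv ℝ h x - (h x / x 1 ^ 2) • (EuclideanSpace.proj 1 : Plane →L[ℝ] ℝ)) x := by
  have h1 : HasFDerivAt (fun y : Plane => y 1) (EuclideanSpace.proj 1 : Plane →L[ℝ] ℝ) x :=
    (EuclideanSpace.proj 1 : Plane →L[ℝ] ℝ).hasFDerivAt
  have h2 := hh.hasFDerivAt.mul ((hasDerivAt_inv hx).comp_hasFDerivAt x h1)
  refine (h2.congr_fderiv ?_).congr_of_eventuallyEq (Eventually.of_forall fun y => ?_)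
  · ext y
    simp [smul_eq_mul]
    ring
  · simp [div_eq_mul_inv]

lemma eventuallyEq_zero_div_coord {h : Plane → ℝ} {δ : ℝ} (hδ : 0 < δ)
    (h0 : ∀ x : Plane, x 1 ≤ δ → h x = 0) {x : Plane} (hx : x 1 ≤ 0) :
    (fun y : Plane => h y / y 1) =ᶠ[𝓝 x] fun _ => 0 := by
  have ho : IsOpen {y : Plane | y 1 < δ} := isOpen_lt (by fun_prop) continuous_const
  filter_upwards [ho.mem_nhds (show x 1 < δ by linarith)] with y hy
  simp [h0 y (le_of_lt hy)]

lemma contDiff_div_coord {h : Plane → ℝ} {δ : ℝ} (hδ : 0 < δ) (hh : ContDiff ℝ 1 h)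
    (h0 : ∀ x : Plane, x 1 ≤ δ → h x = 0) : ContDiff ℝ 1 (fun y : Plane => h y / y 1) := by
  rw [contDiff_iff_contDiffAt]
  intro x
  rcases le_or_gt (x 1) 0 with hx | hx
  · exact contDiffAt_const.congr_of_eventuallyEq (eventuallyEq_zero_div_coord hδ h0 hx)
  · refine hh.contDiffAt.div ?_ hx.ne'
    exact (EuclideanSpace.proj 1 : Plane →L[ℝ] ℝ).contDiff.contDiffAt

lemma integral_pderiv_eq_zero {ψ : Plane → ℝ} (hψ : ContDiff ℝ 1 ψ) (hc : HasCompactSupport ψ)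
    (j : Fin 2) : ∫ x, pderiv j ψ x = 0 := by
  have hcont : Continuous fun x => fderiv ℝ ψ x (EuclideanSpace.single j 1) :=
    (hψ.continuous_fderiv (by norm_num)).clm_apply continuous_const
  have hcs : HasCompactSupport fun x => fderiv ℝ ψ x (EuclideanSpace.single j 1) :=
    hc.fderiv_apply (𝕜 := ℝ) _
  have := integral_mul_fderiv_eq_neg_fderiv_mul_of_integrable (μ := (volume : Measure Plane))
    (f := fun _ : Plane => (1 : ℝ)) (g := ψ) (v := EuclideanSpace.single j 1)
    (by simp) (by simpa using hcont.integrable_of_hasCompactSupport hcs)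
    (by simpa using hψ.continuous.integrable_of_hasCompactSupport hc)
    (fun x _ => differentiableAt_const _) (fun x _ => (hψ.differentiable (by norm_num)) x)
  simpa [pderiv] using this

lemma lintegral_le_of_forall_ball {f : Plane → ℝ≥0∞} {C : ℝ≥0∞}
    (h : ∀ R : ℝ, 0 < R → ∫⁻ x in Metric.ball 0 R, f x ≤ C) : ∫⁻ x, f x ≤ C := by
  have hU : (⋃ n : ℕ, Metric.ball (0 : Plane) (n + 1)) = Set.univ :=
    Metric.iUnion_ball_nat_succ 0
  rw [← setLIntegral_univ, ← hU, setLIntegral_iUnion_of_directed]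
  · exact iSup_le fun n => h _ (by positivity)
  · refine directed_of_isDirected_le fun m n hmn => Metric.ball_subset_ball ?_
    exact_mod_cast Nat.succ_le_succ hmn

/-- Hardy's inequality in the half-plane. -/
lemma hardy_halfPlane {u : Plane → ℝ} {δ : ℝ} (hδ : 0 < δ) (hu : ContDiff ℝ 1 u)
    (h0 : ∀ x : Plane, x 1 ≤ δ → u x = 0) :
    ∫⁻ x : Plane, ENNReal.ofReal (u x ^ 2 / x 1 ^ 2) ≤
      4 * ∫⁻ x, ENNReal.ofReal (‖fderiv ℝ u x‖ ^ 2) := by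
  obtain ⟨K, -, hcut⟩ := exists_cutoff
  refine lintegral_le_of_forall_ball fun R hR => ?_
  obtain ⟨χ, hχ, hχc, hχ0, hχ1, hχR, -, hχd⟩ := hcut R hR
  have hh : ContDiff ℝ 1 (fun x => χ x * u x ^ 2) := hχ.mul (hu.pow 2)
  have hh0 : ∀ x : Plane, x 1 ≤ δ → χ x * u x ^ 2 = 0 := fun x hx => by simp [h0 x hx]
  have hψ := contDiff_div_coord hδ hh hh0
  have hψ2 := contDiff_div_coord hδ hψ (fun x hx => by simp [h0 x hx])
  have hψc : HasCompactSupport (fun x : Plane => χ x * u x ^ 2 / x 1) := by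
    simp_rw [mul_div_assoc]; exact hχc.mul_right
  have hψ2c : HasCompactSupport (fun x : Plane => χ x * u x ^ 2 / x 1 / x 1) := by
    simp_rw [mul_div_assoc]; exact hχc.mul_right
  have hi1 : Integrable (fun x : Plane => χ x * u x ^ 2 / x 1 / x 1) :=
    hψ2.continuous.integrable_of_hasCompactSupport hψ2c
  have hfc : Continuous (fderiv ℝ u) := hu.continuous_fderiv (by norm_num)
  have hi2 : Integrable (fun x : Plane => χ x * ‖fderiv ℝ u x‖ ^ 2) :=
    (hχ.continuous.mul (hfc.norm.pow 2)).integrable_of_hasCompactSupport hχc.mul_right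
  have hi3 : Integrable (fun x : Plane => pderiv 1 (fun x : Plane => χ x * u x ^ 2 / x 1) x) := by
    refine Continuous.integrable_of_hasCompactSupport ?_ (hψc.fderiv_apply (𝕜 := ℝ) _)
    exact (hψ.continuous_fderiv (by norm_num)).clm_apply continuous_const
  -- Differentiating `χ u² / y` in the normal direction produces `-χ u² / y²`. The cross term is
  -- absorbed by the square `(u / y - 2 ∂₁u)² ≥ 0`, and the term with `∂₁χ` has a favourable sign
  -- because `χ` decreases. The derivative itself integrates to zero.
  have hpt : ∀ x : Plane, χ x * u x ^ 2 / x 1 / x 1 / 2 ≤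
      2 * (χ x * ‖fderiv ℝ u x‖ ^ 2) - pderiv 1 (fun x : Plane => χ x * u x ^ 2 / x 1) x := by
    intro x
    rcases le_or_gt (x 1) 0 with hx | hx
    · rw [pderiv, (eventuallyEq_zero_div_coord hδ hh0 hx).fderiv_eq]
      have := hχ0 x
      simp only [h0 x (hx.trans hδ.le)]
      simp
      positivity
    · have hd : HasFDerivAt (fun x => χ x * u x ^ 2)
          (χ x • ((2 * u x) • fderiv ℝ u x) + (u x ^ 2) • fderiv ℝ χ x) x := by
        have h1 := ((hu.differentiable (by norm_num)) x).hasFDerivAt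
        have h2 := ((hχ.differentiable (by norm_num)) x).hasFDerivAt
        refine (h2.mul (h1.pow 2)).congr_fderiv ?_
        ext y; simp
      rw [pderiv, (hasFDerivAt_div_coord hd.differentiableAt hx.ne').fderiv, hd.fderiv]
      have hχd' := hχd x hx
      rw [pderiv] at hχd'
      have hDu : fderiv ℝ u x (EuclideanSpace.single 1 1) ^ 2 ≤ ‖fderiv ℝ u x‖ ^ 2 := by
        rw [sq_le_sq, abs_norm]
        simpa using (fderiv ℝ u x).le_opNorm (EuclideanSpace.single 1 1)
      have hp : (EuclideanSpace.proj 1 : Plane →L[ℝ] ℝ) (EuclideanSpace.single 1 1) = 1 := by simp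
      simp only [sub_apply, smul_apply, add_apply, smul_eq_mul, hp, mul_one]
      set d := fderiv ℝ u x (EuclideanSpace.single 1 1)
      set c := fderiv ℝ χ x (EuclideanSpace.single 1 1)
      set w := (x 1)⁻¹ with hw
      have hw0 : 0 < w := inv_pos.2 hx
      have e1 : χ x * u x ^ 2 / x 1 ^ 2 = χ x * (u x * w) ^ 2 := by
        rw [hw]; field_simp
      have e2 : χ x * u x ^ 2 / x 1 / x 1 = χ x * (u x * w) ^ 2 := by
        rw [hw]; field_simp
      rw [e1, e2]
      have k1 : 0 ≤ χ x * (‖fderiv ℝ u x‖ ^ 2 - d ^ 2) := mul_nonneg (hχ0 x) (by linarith)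
      have k2 : 0 ≤ χ x * (u x * w - 2 * d) ^ 2 := mul_nonneg (hχ0 x) (sq_nonneg _)
      have k3 : 0 ≤ w * (u x ^ 2 * (-c)) :=
        mul_nonneg hw0.le (mul_nonneg (sq_nonneg _) (by linarith))
      nlinarith
  have hint : ∫ x : Plane, χ x * u x ^ 2 / x 1 / x 1 ≤ 4 * ∫ x, χ x * ‖fderiv ℝ u x‖ ^ 2 := by
    have := integral_mono (hi1.div_const 2) ((hi2.const_mul 2).sub hi3) hpt
    rw [integral_sub' (hi2.const_mul 2) hi3, integral_pderiv_eq_zero hψ hψc, integral_div,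
      integral_const_mul] at this
    linarith
  calc ∫⁻ x in Metric.ball 0 R, ENNReal.ofReal (u x ^ 2 / x 1 ^ 2)
      = ∫⁻ x in Metric.ball 0 R, ENNReal.ofReal (χ x * u x ^ 2 / x 1 / x 1) := by
        refine setLIntegral_congr_fun Metric.isOpen_ball.measurableSet fun x hx => ?_
        simp only [hχR x hx, one_mul, div_div, sq]
    _ ≤ ∫⁻ x, ENNReal.ofReal (χ x * u x ^ 2 / x 1 / x 1) := setLIntegral_le_lintegral _ _
    _ = ENNReal.ofReal (∫ x : Plane, χ x * u x ^ 2 / x 1 / x 1) := by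
        rw [ofReal_integral_eq_lintegral_ofReal hi1]
        refine Eventually.of_forall fun x => ?_
        simp only [div_div, ← sq, Pi.zero_apply]
        have := hχ0 x
        positivity
    _ ≤ ENNReal.ofReal (4 * ∫ x, χ x * ‖fderiv ℝ u x‖ ^ 2) := ENNReal.ofReal_le_ofReal hint
    _ = 4 * ∫⁻ x, ENNReal.ofReal (χ x * ‖fderiv ℝ u x‖ ^ 2) := by
        rw [ENNReal.ofReal_mul (by norm_num), ofReal_integral_eq_lintegral_ofReal hi2]
        · norm_num
        · exact Eventually.of_forall fun x => mul_nonneg (hχ0 x) (sq_nonneg _)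
    _ ≤ _ := by
        gcongr with x
        exact mul_le_of_le_one_left (sq_nonneg _) (hχ1 x)

/-! ### Weighted bounds for higher powers. -/

lemma abs_pow_succ_le_sq_add_pow {m : ℕ} (hm : 1 ≤ m) (t : ℝ) :
    |t| ^ (m + 1) ≤ t ^ 2 + t ^ (2 * m) := by
  have h2 : t ^ (2 * m) = |t| ^ (2 * m) := by rw [pow_mul, pow_mul, sq_abs]
  rw [h2, ← sq_abs t]
  rcases le_total |t| 1 with h | h
  · have := pow_le_pow_of_le_one (abs_nonneg t) h (show 2 ≤ m + 1 by omega)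
    linarith [pow_nonneg (abs_nonneg t) (2 * m)]
  · have := pow_le_pow_right₀ h (show m + 1 ≤ 2 * m by omega)
    linarith [pow_nonneg (abs_nonneg t) 2]

/-- One step of the bootstrap for weighted powers. -/
lemma exists_lintegral_pow_div_le_step (m : ℕ) (hm : 1 ≤ m) : ∃ C : ℝ≥0∞, C ≠ ⊤ ∧
    ∀ (u : Plane → ℝ) (δ : ℝ), 0 < δ → ContDiff ℝ 1 u → (∀ x : Plane, x 1 ≤ δ → u x = 0) →
    ∫⁻ x : Plane, ENNReal.ofReal (u x ^ (2 * (m + 1)) / x 1 ^ 2) ≤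
      C * ((∫⁻ x : Plane, ENNReal.ofReal (u x ^ 2 / x 1 ^ 2)) +
        (∫⁻ x : Plane, ENNReal.ofReal (u x ^ (2 * m) / x 1 ^ 2)) +
        ∫⁻ x, ENNReal.ofReal (‖fderiv ℝ u x‖ ^ 2)) ^ 2 := by
  obtain ⟨K, hK0, hcut⟩ := exists_cutoff
  have hconj : Real.HolderConjugate (Module.finrank ℝ Plane) 2 := by
    rw [finrank_euclideanSpace_fin]; exact_mod_cast Real.HolderConjugate.two_two
  refine ⟨lintegralPowLePowLIntegralFDerivConst (volume : Measure Plane) 2 *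
    ENNReal.ofReal (K + m + 2) ^ 2, by finiteness, fun u δ hδ hu h0 => ?_⟩
  refine lintegral_le_of_forall_ball fun R hR => ?_
  obtain ⟨χ, hχ, hχc, hχ0, hχ1, hχR, hχK, -⟩ := hcut R hR
  have hh : ContDiff ℝ 1 (fun x => χ x * u x ^ (m + 1)) := hχ.mul (hu.pow _)
  have hh0 : ∀ x : Plane, x 1 ≤ δ → χ x * u x ^ (m + 1) = 0 := fun x hx => by simp [h0 x hx]
  have hψ := contDiff_div_coord hδ hh hh0
  have hψc : HasCompactSupport (fun x : Plane => χ x * u x ^ (m + 1) / x 1) := by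
    simp_rw [mul_div_assoc]; exact hχc.mul_right
  have hgns := lintegral_pow_le_pow_lintegral_fderiv (volume : Measure Plane) hψ hψc hconj
  -- Derivatives falling on `1 / y` or on `χ` cost at most `(K + 1) |u|^(m+1) / y²`, thanks to `‖∇χ‖
  -- ≤ K / y`, and `|u|^(m+1) ≤ u² + u^(2m)`. The remaining term `(m + 1) |u|^m ‖∇u‖ / y` is split
  -- by Young's inequality.
  have hpt : ∀ x : Plane, ‖fderiv ℝ (fun x : Plane => χ x * u x ^ (m + 1) / x 1) x‖ ≤
      (K + m + 2) * (u x ^ 2 / x 1 ^ 2 + u x ^ (2 * m) / x 1 ^ 2 + ‖fderiv ℝ u x‖ ^ 2) := by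
    intro x
    have he : 0 ≤ u x ^ (2 * m) := by rw [pow_mul]; positivity
    rcases le_or_gt (x 1) 0 with hx | hx
    · rw [(eventuallyEq_zero_div_coord hδ hh0 hx).fderiv_eq]
      simp
      positivity
    · have hd : HasFDerivAt (fun x => χ x * u x ^ (m + 1))
          (χ x • (((m + 1 : ℝ) * u x ^ m) • fderiv ℝ u x) + (u x ^ (m + 1)) • fderiv ℝ χ x) x := by
        have h1 := ((hu.differentiable (by norm_num)) x).hasFDerivAt
        have h2 := ((hχ.differentiable (by norm_num)) x).hasFDerivAt
        refine (h2.mul (h1.pow (m + 1))).congr_fderiv ?_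
        ext y; simp
      rw [(hasFDerivAt_div_coord hd.differentiableAt hx.ne').fderiv, hd.fderiv]
      set w := (x 1)⁻¹ with hw
      have hw0 : 0 < w := inv_pos.2 hx
      set G := ‖fderiv ℝ u x‖ with hG
      set a := |u x| with ha
      have hG0 : 0 ≤ G := norm_nonneg _
      have ha0 : 0 ≤ a := abs_nonneg _
      have n1 : ‖χ x • (((m + 1 : ℝ) * u x ^ m) • fderiv ℝ u x) +
          (u x ^ (m + 1)) • fderiv ℝ χ x‖ ≤ (m + 1) * a ^ m * G + a ^ (m + 1) * (K * w) := by
        refine (norm_add_le _ _).trans (add_le_add ?_ ?_)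
        · rw [norm_smul, norm_smul, norm_mul, Real.norm_of_nonneg (hχ0 x), norm_pow,
            Real.norm_eq_abs (u x), Real.norm_of_nonneg (by positivity : (0 : ℝ) ≤ m + 1)]
          exact mul_le_of_le_one_left (by positivity) (hχ1 x)
        · rw [norm_smul, norm_pow, Real.norm_eq_abs]
          gcongr
          exact hχK x hx
      have n2 : ‖(χ x * u x ^ (m + 1) / x 1 ^ 2) • (EuclideanSpace.proj 1 : Plane →L[ℝ] ℝ)‖ ≤
          a ^ (m + 1) * w ^ 2 := by
        rw [norm_smul, div_eq_mul_inv, norm_mul, norm_mul, Real.norm_of_nonneg (hχ0 x), norm_pow,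
          Real.norm_eq_abs (u x), ← inv_pow, Real.norm_of_nonneg (by positivity : 0 ≤ (x 1)⁻¹ ^ 2)]
        calc χ x * a ^ (m + 1) * w ^ 2 * ‖(EuclideanSpace.proj 1 : Plane →L[ℝ] ℝ)‖
            ≤ 1 * a ^ (m + 1) * w ^ 2 * 1 := by
              gcongr
              · exact hχ1 x
              · exact norm_coord_proj_le 1
          _ = _ := by ring
      have n3 : ‖(x 1)⁻¹ • (χ x • (((m + 1 : ℝ) * u x ^ m) • fderiv ℝ u x) +
          (u x ^ (m + 1)) • fderiv ℝ χ x)‖ ≤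
          w * ((m + 1) * a ^ m * G + a ^ (m + 1) * (K * w)) := by
        rw [norm_smul, Real.norm_of_nonneg hw0.le]
        gcongr
      refine ((norm_sub_le _ _).trans (add_le_add n3 n2)).trans ?_
      have e1 : u x ^ 2 / x 1 ^ 2 = u x ^ 2 * w ^ 2 := by rw [hw]; field_simp
      have e2 : u x ^ (2 * m) / x 1 ^ 2 = u x ^ (2 * m) * w ^ 2 := by rw [hw]; field_simp
      rw [e1, e2]
      have p1 := mul_le_mul_of_nonneg_right (abs_pow_succ_le_sq_add_pow hm (u x)) (sq_nonneg w)
      have ee : u x ^ (2 * m) = (a ^ m) ^ 2 := by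
        rw [ha, ← abs_pow, sq_abs, ← pow_mul, mul_comm]
      have p2 : a ^ m * w * G ≤ u x ^ (2 * m) * w ^ 2 + G ^ 2 := by
        rw [ee]
        nlinarith [sq_nonneg (a ^ m * w - G), sq_nonneg (a ^ m * w), sq_nonneg G]
      have q1 : (K + 1) * (a ^ (m + 1) * w ^ 2) ≤
          (K + 1) * (u x ^ 2 * w ^ 2 + u x ^ (2 * m) * w ^ 2) := by
        gcongr; linarith
      have q2 : (m + 1) * (a ^ m * w * G) ≤
          ((m : ℝ) + 1) * (u x ^ (2 * m) * w ^ 2 + G ^ 2) := by gcongr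
      have q3 : 0 ≤ (K + 1) * G ^ 2 := by positivity
      have q4 : 0 ≤ ((m : ℝ) + 1) * (u x ^ 2 * w ^ 2) := by positivity
      linarith
  have hum : Measurable u := hu.continuous.measurable
  have hx1 : Measurable (fun x : Plane => x 1) :=
    (by fun_prop : Continuous fun x : Plane => x 1).measurable
  calc ∫⁻ x in Metric.ball 0 R, ENNReal.ofReal (u x ^ (2 * (m + 1)) / x 1 ^ 2)
      = ∫⁻ x in Metric.ball 0 R, ‖χ x * u x ^ (m + 1) / x 1‖ₑ ^ (2 : ℝ) := by
        refine setLIntegral_congr_fun Metric.isOpen_ball.measurableSet fun x hx => ?_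
        simp only [hχR x hx, one_mul]
        rw [Real.enorm_eq_ofReal_abs, ENNReal.rpow_two, ← ENNReal.ofReal_pow (abs_nonneg _),
          sq_abs, div_pow, ← pow_mul, mul_comm 2]
    _ ≤ ∫⁻ x : Plane, ‖χ x * u x ^ (m + 1) / x 1‖ₑ ^ (2 : ℝ) := setLIntegral_le_lintegral _ _
    _ ≤ lintegralPowLePowLIntegralFDerivConst (volume : Measure Plane) 2 *
        (∫⁻ x, ‖fderiv ℝ (fun x : Plane => χ x * u x ^ (m + 1) / x 1) x‖ₑ) ^ (2 : ℝ) := hgns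
    _ ≤ lintegralPowLePowLIntegralFDerivConst (volume : Measure Plane) 2 *
        (ENNReal.ofReal (K + m + 2) * ((∫⁻ x : Plane, ENNReal.ofReal (u x ^ 2 / x 1 ^ 2)) +
        (∫⁻ x : Plane, ENNReal.ofReal (u x ^ (2 * m) / x 1 ^ 2)) +
        ∫⁻ x, ENNReal.ofReal (‖fderiv ℝ u x‖ ^ 2))) ^ (2 : ℝ) := by
        gcongr
        rw [← lintegral_add_left (by fun_prop), ← lintegral_add_left (by fun_prop),
          ← lintegral_const_mul' _ _ (by finiteness)]
        refine lintegral_mono fun x => ?_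
        have he : 0 ≤ u x ^ (2 * m) := by rw [pow_mul]; positivity
        rw [← ENNReal.ofReal_add (by positivity) (by positivity),
          ← ENNReal.ofReal_add (by positivity) (by positivity),
          ← ENNReal.ofReal_mul (by positivity), ← ofReal_norm]
        exact ENNReal.ofReal_le_ofReal (hpt x)
    _ = _ := by
        rw [ENNReal.rpow_two, mul_pow, mul_assoc]

/-- Weighted Sobolev inequality for smooth functions supported away from the boundary, normalized
by the Dirichlet integral. -/
lemma exists_lintegral_pow_div_le (m : ℕ) : ∃ C : ℝ≥0∞, C ≠ ⊤ ∧
    ∀ (u : Plane → ℝ) (δ : ℝ), 0 < δ → ContDiff ℝ 1 u → (∀ x : Plane, x 1 ≤ δ → u x = 0) →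
    ∫⁻ x, ENNReal.ofReal (‖fderiv ℝ u x‖ ^ 2) ≤ 1 →
    ∫⁻ x : Plane, ENNReal.ofReal (u x ^ (2 * (m + 1)) / x 1 ^ 2) ≤ C := by
  induction m with
  | zero =>
    refine ⟨4, by norm_num, fun u δ hδ hu h0 hD => ?_⟩
    calc _ ≤ 4 * ∫⁻ x, ENNReal.ofReal (‖fderiv ℝ u x‖ ^ 2) := hardy_halfPlane hδ hu h0
      _ ≤ 4 * 1 := by gcongr
      _ = 4 := mul_one _
  | succ m ih =>
    obtain ⟨C, hC, h⟩ := ih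
    obtain ⟨C', hC', h'⟩ := exists_lintegral_pow_div_le_step (m + 1) (by omega)
    -- The summands are Hardy's constant, the inductive bound and the normalized Dirichlet integral.
    refine ⟨C' * (4 + C + 1) ^ 2, by finiteness, fun u δ hδ hu h0 hD => ?_⟩
    refine (h' u δ hδ hu h0).trans ?_
    gcongr
    · calc _ ≤ 4 * ∫⁻ x, ENNReal.ofReal (‖fderiv ℝ u x‖ ^ 2) := hardy_halfPlane hδ hu h0
        _ ≤ 4 * 1 := by gcongr
        _ = 4 := mul_one _
    · exact h u δ hδ hu h0 hD

/-- Weighted Sobolev inequality for smooth functions supported away from the boundary. -/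
lemma exists_lintegral_pow_div_le_mul_pow (m : ℕ) : ∃ C : ℝ≥0∞, C ≠ ⊤ ∧
    ∀ (u : Plane → ℝ) (δ t : ℝ), 0 < δ → 0 < t → ContDiff ℝ 1 u →
    (∀ x : Plane, x 1 ≤ δ → u x = 0) →
    ∫⁻ x, ENNReal.ofReal (‖fderiv ℝ u x‖ ^ 2) ≤ ENNReal.ofReal (t ^ 2) →
    ∫⁻ x : Plane, ENNReal.ofReal (u x ^ (2 * (m + 1)) / x 1 ^ 2) ≤
      C * ENNReal.ofReal (t ^ (2 * (m + 1))) := by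
  obtain ⟨C, hC, h⟩ := exists_lintegral_pow_div_le m
  refine ⟨C, hC, fun u δ t hδ ht hu h0 hD => ?_⟩
  -- Scaling `u` to Dirichlet integral at most one restores the homogeneity that the additive
  -- bootstrap lost.
  have key := h (fun x => t⁻¹ * u x) δ hδ (contDiff_const.mul hu) (fun x hx => by simp [h0 x hx]) ?_
  · calc ∫⁻ x : Plane, ENNReal.ofReal (u x ^ (2 * (m + 1)) / x 1 ^ 2)
        = ∫⁻ x : Plane, ENNReal.ofReal ((t⁻¹ * u x) ^ (2 * (m + 1)) / x 1 ^ 2) *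
            ENNReal.ofReal (t ^ (2 * (m + 1))) := by
          refine lintegral_congr fun x => ?_
          rw [← ENNReal.ofReal_mul' (by positivity)]
          congr 1
          rw [mul_pow, inv_pow]
          field_simp
      _ = (∫⁻ x : Plane, ENNReal.ofReal ((t⁻¹ * u x) ^ (2 * (m + 1)) / x 1 ^ 2)) *
            ENNReal.ofReal (t ^ (2 * (m + 1))) := lintegral_mul_const' _ _ (by finiteness)
      _ ≤ _ := by gcongr
  · calc ∫⁻ x, ENNReal.ofReal (‖fderiv ℝ (fun x => t⁻¹ * u x) x‖ ^ 2)
        = ∫⁻ x, ENNReal.ofReal (t⁻¹ ^ 2) * ENNReal.ofReal (‖fderiv ℝ u x‖ ^ 2) := by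
          refine lintegral_congr fun x => ?_
          rw [← ENNReal.ofReal_mul (by positivity),
            fderiv_const_mul ((hu.differentiable (by norm_num)) x), norm_smul,
            Real.norm_of_nonneg (by positivity), mul_pow]
      _ = ENNReal.ofReal (t⁻¹ ^ 2) * ∫⁻ x, ENNReal.ofReal (‖fderiv ℝ u x‖ ^ 2) :=
          lintegral_const_mul' _ _ (by finiteness)
      _ ≤ ENNReal.ofReal (t⁻¹ ^ 2) * ENNReal.ofReal (t ^ 2) := by gcongr
      _ = 1 := by
          rw [← ENNReal.ofReal_mul (by positivity), ← mul_pow, inv_mul_cancel₀ ht.ne']; simp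

/-! ### Mollification and passage to weakly differentiable functions. -/

/-- Averaging against a probability density does not increase the `L²` norm. -/
lemma lintegral_sq_integral_mul_le {ρ g : Plane → ℝ} (hρ : Continuous ρ) (hρ0 : ∀ x, 0 ≤ ρ x)
    (hρ1 : ∫⁻ x, ENNReal.ofReal (ρ x) = 1) (hg : AEStronglyMeasurable g) :
    ∫⁻ x, ENNReal.ofReal ((∫ t, ρ (x - t) * g t) ^ 2) ≤ ∫⁻ x, ENNReal.ofReal (g x ^ 2) := by
  have hgm : AEMeasurable (fun t => ENNReal.ofReal (g t ^ 2)) :=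
    (hg.aemeasurable.pow_const 2).ennreal_ofReal
  have hρm : ∀ x, AEMeasurable (fun t => ENNReal.ofReal (ρ (x - t))) := fun x =>
    (hρ.comp (continuous_const.sub continuous_id)).measurable.ennreal_ofReal.aemeasurable
  have hl : ∀ x, ∫⁻ t, ENNReal.ofReal (ρ (x - t)) = 1 := fun x => by
    rw [← hρ1]; exact lintegral_sub_left_eq_self (fun t => ENNReal.ofReal (ρ t)) x
  have hr : ∀ t, ∫⁻ x, ENNReal.ofReal (ρ (x - t)) = 1 := fun t => by
    rw [← hρ1]; exact lintegral_sub_right_eq_self (fun t => ENNReal.ofReal (ρ t)) t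
  have hpt : ∀ x, ENNReal.ofReal ((∫ t, ρ (x - t) * g t) ^ 2) ≤
      ∫⁻ t, ENNReal.ofReal (ρ (x - t)) * ENNReal.ofReal (g t ^ 2) := by
    intro x
    -- Cauchy–Schwarz for `ρ |g| = ρ^(1/2) (ρ g²)^(1/2)`; Tonelli's theorem then finishes, as every
    -- translate of `ρ` has mass one.
    have h1 : ‖∫ t, ρ (x - t) * g t‖ₑ ≤ (∫⁻ t, ENNReal.ofReal (ρ (x - t))) ^ (1 / 2 : ℝ) *
        (∫⁻ t, ENNReal.ofReal (ρ (x - t)) * ENNReal.ofReal (g t ^ 2)) ^ (1 / 2 : ℝ) := by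
      refine (enorm_integral_le_lintegral_enorm _).trans ?_
      refine le_trans (le_of_eq (lintegral_congr fun t => ?_))
        (ENNReal.lintegral_mul_norm_pow_le (hρm x) ((hρm x).mul hgm) (by norm_num) (by norm_num)
          (by norm_num))
      change _ = ENNReal.ofReal (ρ (x - t)) ^ (1 / 2 : ℝ) *
        (ENNReal.ofReal (ρ (x - t)) * ENNReal.ofReal (g t ^ 2)) ^ (1 / 2 : ℝ)
      rw [ENNReal.mul_rpow_of_nonneg _ _ (by norm_num), ← mul_assoc,
        ← ENNReal.rpow_add_of_nonneg _ _ (by norm_num) (by norm_num), enorm_mul,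
        Real.enorm_of_nonneg (hρ0 _), Real.enorm_eq_ofReal_abs, ← sq_abs (g t),
        ENNReal.ofReal_pow (abs_nonneg _), ← ENNReal.rpow_two, ← ENNReal.rpow_mul]
      norm_num
    rw [hl x, ENNReal.one_rpow, one_mul] at h1
    calc ENNReal.ofReal ((∫ t, ρ (x - t) * g t) ^ 2) = ‖∫ t, ρ (x - t) * g t‖ₑ ^ 2 := by
          rw [Real.enorm_eq_ofReal_abs, ← ENNReal.ofReal_pow (abs_nonneg _), sq_abs]
      _ ≤ ((∫⁻ t, ENNReal.ofReal (ρ (x - t)) * ENNReal.ofReal (g t ^ 2)) ^ (1 / 2 : ℝ)) ^ 2 := by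
          gcongr
      _ = _ := by rw [← ENNReal.rpow_two, ← ENNReal.rpow_mul]; norm_num
  have hjm : AEMeasurable (Function.uncurry fun x t : Plane =>
      ENNReal.ofReal (ρ (x - t)) * ENNReal.ofReal (g t ^ 2)) (volume.prod volume) := by
    have h1 : AEMeasurable (fun z : Plane × Plane => ENNReal.ofReal (ρ (z.1 - z.2)))
        (volume.prod volume) :=
      (hρ.comp (continuous_fst.sub continuous_snd)).measurable.ennreal_ofReal.aemeasurable
    exact h1.mul (hgm.comp_quasiMeasurePreserving Measure.quasiMeasurePreserving_snd)
  calc _ ≤ ∫⁻ x, ∫⁻ t, ENNReal.ofReal (ρ (x - t)) * ENNReal.ofReal (g t ^ 2) := lintegral_mono hpt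
    _ = ∫⁻ t, ∫⁻ x, ENNReal.ofReal (ρ (x - t)) * ENNReal.ofReal (g t ^ 2) :=
        lintegral_lintegral_swap hjm
    _ = _ := by
        refine lintegral_congr fun t => ?_
        rw [lintegral_mul_const' _ _ (by finiteness), hr, one_mul]

/-- The mollification of `u` at the scale of the bump function `φ`. -/
noncomputable def mollify (φ : ContDiffBump (0 : Plane)) (u : Plane → ℝ) : Plane → ℝ :=
  φ.normed volume ⋆[ContinuousLinearMap.lsmul ℝ ℝ, volume] u

lemma contDiff_mollify (φ : ContDiffBump (0 : Plane)) {u : Plane → ℝ}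
    (hu : LocallyIntegrable u) : ContDiff ℝ 1 (mollify φ u) :=
  φ.hasCompactSupport_normed.contDiff_convolution_left (n := 1) _ φ.contDiff_normed hu

lemma mollify_eq_zero (φ : ContDiffBump (0 : Plane)) {u : Plane → ℝ}
    (h0 : ∀ x : Plane, x 1 ≤ 0 → u x = 0) {x : Plane} (hx : x 1 ≤ -φ.rOut) :
    mollify φ u x = 0 := by
  rw [mollify, convolution_def]
  refine integral_eq_zero_of_ae (Eventually.of_forall fun t => ?_)
  by_cases ht : t ∈ Metric.ball (0 : Plane) φ.rOut
  · have h1 : ‖t‖ < φ.rOut := by simpa using ht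
    have h2 := (abs_le.1 (abs_coord_le_norm t 1)).1
    simp [h0 (x - t) (by simp; linarith)]
  · rw [← φ.support_normed_eq (μ := volume), Function.notMem_support] at ht
    simp [ht]

/-- The derivative falls on the kernel, and the reflected kernel `ρ (x - ·)` is an admissible test
function; the reflection supplies the sign that cancels the one in `hw`. -/
lemma fderiv_mollify_apply (φ : ContDiffBump (0 : Plane)) {u g : Plane → ℝ} {j : Fin 2}
    (hu : LocallyIntegrable u)
    (hw : ∀ ψ : Plane → ℝ, ContDiff ℝ ∞ ψ → HasCompactSupport ψ →
      ∫ x, u x * pderiv j ψ x = -∫ x, g x * ψ x) (x : Plane) :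
    fderiv ℝ (mollify φ u) x (EuclideanSpace.single j 1) =
      ∫ t, φ.normed volume (x - t) * g t := by
  set ρ : Plane → ℝ := φ.normed volume with hρ
  have hρs : ContDiff ℝ ∞ ρ := φ.contDiff_normed
  have hρc : HasCompactSupport ρ := φ.hasCompactSupport_normed
  have hρ1 : ContDiff ℝ 1 ρ := φ.contDiff_normed (n := 1)
  have hd := hρc.hasFDerivAt_convolution_left (ContinuousLinearMap.lsmul ℝ ℝ) hρ1 hu x
  have hex := (hρc.fderiv (𝕜 := ℝ)).convolutionExists_left
    ((ContinuousLinearMap.lsmul ℝ ℝ : ℝ →L[ℝ] ℝ →L[ℝ] ℝ).precompL Plane)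
    (hρ1.continuous_fderiv (by norm_num)) hu x
  rw [mollify, hd.fderiv, convolution_eq_swap, ContinuousLinearMap.integral_apply hex.integrable_swap]
  have hψ := hw (fun t => ρ (x - t)) (hρs.comp (contDiff_const.sub contDiff_id))
    (hρc.comp_homeomorph (Homeomorph.subLeft x))
  have hpd : ∀ t, pderiv j (fun t => ρ (x - t)) t =
      -fderiv ℝ ρ (x - t) (EuclideanSpace.single j 1) := by
    intro t
    have h1 := ((hρ1.differentiable (by norm_num)) (x - t)).hasFDerivAt.comp t
      ((hasFDerivAt_id t).const_sub x)
    have h2 : HasFDerivAt (fun t => ρ (x - t)) _ t := h1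
    rw [pderiv, h2.fderiv]
    simp
  simp_rw [hpd, mul_neg, integral_neg, neg_inj] at hψ
  simp_rw [mul_comm (ρ _), ← hψ]
  refine integral_congr_ae (Eventually.of_forall fun t => ?_)
  simp [ContinuousLinearMap.precompL_apply, mul_comm]

lemma norm_sq_le_two_mul_sum (T : Plane →L[ℝ] ℝ) :
    ‖T‖ ^ 2 ≤ 2 * ∑ j, T (EuclideanSpace.single j 1) ^ 2 := by
  have h : ‖T‖ ≤ |T (EuclideanSpace.single 0 1)| + |T (EuclideanSpace.single 1 1)| := by
    refine T.opNorm_le_bound (by positivity) fun x => ?_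
    have hx : x = x 0 • EuclideanSpace.single 0 1 + x 1 • EuclideanSpace.single 1 1 := by
      ext i; fin_cases i <;> simp
    have hT : T x = x 0 * T (EuclideanSpace.single 0 1) + x 1 * T (EuclideanSpace.single 1 1) := by
      conv_lhs => rw [hx]
      simp
    rw [hT, Real.norm_eq_abs]
    refine (abs_add_le _ _).trans ?_
    rw [abs_mul, abs_mul, add_mul, mul_comm, mul_comm |x 1|]
    gcongr <;> exact abs_coord_le_norm _ _
  rw [Fin.sum_univ_two, ← sq_abs (T (EuclideanSpace.single 0 1)),
    ← sq_abs (T (EuclideanSpace.single 1 1))]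
  nlinarith [sq_nonneg (|T (EuclideanSpace.single 0 1)| - |T (EuclideanSpace.single 1 1)|),
    norm_nonneg T]

lemma lintegral_norm_fderiv_mollify_sq_le (φ : ContDiffBump (0 : Plane)) {u : Plane → ℝ}
    {g : Fin 2 → Plane → ℝ} (hu : LocallyIntegrable u) (hg : ∀ j, AEStronglyMeasurable (g j))
    (hw : ∀ ψ : Plane → ℝ, ContDiff ℝ ∞ ψ → HasCompactSupport ψ → ∀ j,
      ∫ x, u x * pderiv j ψ x = -∫ x, g j x * ψ x) :
    ∫⁻ x, ENNReal.ofReal (‖fderiv ℝ (mollify φ u) x‖ ^ 2) ≤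
      2 * ∑ j, ∫⁻ x, ENNReal.ofReal (g j x ^ 2) := by
  have hρ1 : ∫⁻ x, ENNReal.ofReal (φ.normed volume x) = 1 := by
    rw [← ofReal_integral_eq_lintegral_ofReal φ.integrable_normed
      (Eventually.of_forall φ.nonneg_normed), φ.integral_normed, ENNReal.ofReal_one]
  have hc : Continuous (fderiv ℝ (mollify φ u)) :=
    (contDiff_mollify φ hu).continuous_fderiv (by norm_num)
  calc ∫⁻ x, ENNReal.ofReal (‖fderiv ℝ (mollify φ u) x‖ ^ 2)
      ≤ ∫⁻ x, 2 * ∑ j,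
        ENNReal.ofReal (fderiv ℝ (mollify φ u) x (EuclideanSpace.single j 1) ^ 2) := by
        refine lintegral_mono fun x => ?_
        refine (ENNReal.ofReal_le_ofReal (norm_sq_le_two_mul_sum _)).trans ?_
        rw [ENNReal.ofReal_mul (by norm_num), ENNReal.ofReal_sum_of_nonneg fun _ _ => sq_nonneg _]
        simp
    _ = 2 * ∑ j, ∫⁻ x,
        ENNReal.ofReal (fderiv ℝ (mollify φ u) x (EuclideanSpace.single j 1) ^ 2) := by
        rw [lintegral_const_mul' _ _ (by norm_num), lintegral_finsetSum]
        intro j _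
        exact ((hc.clm_apply continuous_const).pow 2).measurable.ennreal_ofReal
    _ ≤ _ := by
        refine mul_le_mul' le_rfl (Finset.sum_le_sum fun j _ => ?_)
        simp_rw [fderiv_mollify_apply φ hu (fun ψ h1 h2 => hw ψ h1 h2 j)]
        exact lintegral_sq_integral_mul_le φ.continuous_normed φ.nonneg_normed hρ1 (hg j)

/-- Weighted Sobolev inequality in the half-plane for functions whose extension by zero has a
square-integrable weak gradient. -/
lemma exists_lintegral_pow_div_le_of_weakDeriv (m : ℕ) : ∃ C : ℝ≥0∞, C ≠ ⊤ ∧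
    ∀ (u : Plane → ℝ) (g : Fin 2 → Plane → ℝ) (t : ℝ), 0 < t → LocallyIntegrable u →
    (∀ j, AEStronglyMeasurable (g j)) → (∀ x : Plane, x 1 ≤ 0 → u x = 0) →
    (∀ ψ : Plane → ℝ, ContDiff ℝ ∞ ψ → HasCompactSupport ψ → ∀ j,
      ∫ x, u x * pderiv j ψ x = -∫ x, g j x * ψ x) →
    2 * ∑ j, ∫⁻ x, ENNReal.ofReal (g j x ^ 2) ≤ ENNReal.ofReal (t ^ 2) →
    ∫⁻ x : Plane, ENNReal.ofReal (u x ^ (2 * (m + 1)) / x 1 ^ 2) ∂halfVol ≤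
      C * ENNReal.ofReal (t ^ (2 * (m + 1))) := by
  obtain ⟨C, hC, h⟩ := exists_lintegral_pow_div_le_mul_pow m
  refine ⟨C, hC, fun u g t ht hu hg h0 hw hD => ?_⟩
  -- The fixed ratio 2 between outer and inner radius is what gives convergence almost everywhere
  -- for a merely locally integrable `u`.
  let φ : ℕ → ContDiffBump (0 : Plane) := fun n =>
    ⟨1 / ((n : ℝ) + 1), 2 * (1 / ((n : ℝ) + 1)), by positivity,
      lt_mul_of_one_lt_left (by positivity) one_lt_two⟩
  have hr : Tendsto (fun n => (φ n).rOut) atTop (𝓝 0) := by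
    have := (tendsto_one_div_add_atTop_nhds_zero_nat (𝕜 := ℝ)).const_mul 2
    rwa [mul_zero] at this
  have hlim := ContDiffBump.ae_convolution_tendsto_right_of_locallyIntegrable (K := 2) hr
    (Eventually.of_forall fun n => le_rfl) hu
  have hn : ∀ n, ∫⁻ x : Plane, ENNReal.ofReal
      (mollify (φ n) u x ^ (2 * (m + 1)) / (x 1 + 2 * (φ n).rOut) ^ 2) ≤
      C * ENNReal.ofReal (t ^ (2 * (m + 1))) := by
    intro n
    set r := (φ n).rOut with hrdef
    have hr0 : 0 < r := (φ n).rOut_pos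
    -- The mollification vanishes only for `x 1 ≤ -r`; moved up by `2 * r` it vanishes for `x 1 ≤
    -- r`, so the smooth case applies with `δ = r`. Undoing the shift turns the weight into `(x 1 +
    -- 2 * r)⁻²`.
    set a : Plane := EuclideanSpace.single 1 (2 * r) with ha
    have ha1 : a 1 = 2 * r := by simp [ha]
    have hcd := contDiff_mollify (φ n) hu
    have key := h (fun x => mollify (φ n) u (x - a)) r t hr0 ht
      (hcd.comp (contDiff_id.sub contDiff_const))
      (fun x hx => mollify_eq_zero (φ n) h0 (by simp [ha1]; linarith)) ?_
    · rw [← lintegral_sub_right_eq_self _ a]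
      simpa [ha1] using key
    · have hfd : ∀ x, fderiv ℝ (fun x => mollify (φ n) u (x - a)) x =
          fderiv ℝ (mollify (φ n) u) (x - a) := fun x => fderiv_comp_sub a
      simp_rw [hfd]
      rw [lintegral_sub_right_eq_self
        (fun x => ENNReal.ofReal (‖fderiv ℝ (mollify (φ n) u) x‖ ^ 2)) a]
      exact (lintegral_norm_fderiv_mollify_sq_le (φ n) hu hg hw).trans hD
  have hmeas : ∀ n, Measurable fun x : Plane => ENNReal.ofReal
      (mollify (φ n) u x ^ (2 * (m + 1)) / (x 1 + 2 * (φ n).rOut) ^ 2) := fun n => by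
    have h1 : Measurable (mollify (φ n) u) := (contDiff_mollify (φ n) hu).continuous.measurable
    have h2 : Measurable (fun x : Plane => x 1) :=
      (by fun_prop : Continuous fun x : Plane => x 1).measurable
    fun_prop
  have hhp : MeasurableSet halfPlane :=
    (isOpen_lt continuous_const (by fun_prop : Continuous fun x : Plane => x 1)).measurableSet
  calc ∫⁻ x : Plane, ENNReal.ofReal (u x ^ (2 * (m + 1)) / x 1 ^ 2) ∂halfVol
      = ∫⁻ x : Plane, liminf (fun n => ENNReal.ofReal
          (mollify (φ n) u x ^ (2 * (m + 1)) / (x 1 + 2 * (φ n).rOut) ^ 2)) atTop ∂halfVol := by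
        refine lintegral_congr_ae ?_
        filter_upwards [ae_restrict_of_ae hlim, ae_restrict_mem hhp] with x hx hx0
        have hx1 : x 1 ≠ 0 := ne_of_gt hx0
        refine (Tendsto.liminf_eq ?_).symm
        refine ENNReal.tendsto_ofReal (Tendsto.div (hx.pow _) ?_ (pow_ne_zero 2 hx1))
        have := ((hr.const_mul 2).const_add (x 1)).pow 2
        simpa using this
    _ ≤ liminf (fun n => ∫⁻ x : Plane, ENNReal.ofReal
          (mollify (φ n) u x ^ (2 * (m + 1)) / (x 1 + 2 * (φ n).rOut) ^ 2) ∂halfVol) atTop :=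
        lintegral_liminf_le hmeas
    _ ≤ liminf (fun _ : ℕ => C * ENNReal.ofReal (t ^ (2 * (m + 1)))) atTop := by
        refine liminf_le_liminf (Eventually.of_forall fun n => ?_)
        exact (setLIntegral_le_lintegral _ _).trans (hn n)
    _ = _ := liminf_const _

/-! ### Extension by zero of fields with vanishing trace. -/

lemma measurableSet_halfPlane : MeasurableSet halfPlane :=
  (isOpen_lt continuous_const (by fun_prop : Continuous fun x : Plane => x 1)).measurableSet

lemma locallyIntegrable_indicator_halfPlane {f : Plane → ℝ} (hf : LocallyIntegrable f halfVol) :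
    LocallyIntegrable (halfPlane.indicator f) := by
  intro x
  obtain ⟨s, hs, hfs⟩ := hf x
  refine ⟨s, hs, ?_⟩
  rw [IntegrableOn, integrable_indicator_iff measurableSet_halfPlane, IntegrableOn,
    Measure.restrict_comm measurableSet_halfPlane]
  exact hfs

lemma eLpNorm_pow_eq_lintegral {E : Type*} [NormedAddCommGroup E] (f : Plane → E) (μ : Measure Plane)
    (n : ℕ) [NeZero n] : eLpNorm f n μ ^ n = ∫⁻ x, ‖f x‖ₑ ^ n ∂μ := by
  have := eLpNorm_nnreal_pow_eq_lintegral (f := f) (μ := μ) (p := (n : NNReal))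
    (by exact_mod_cast NeZero.ne n)
  simpa using this

/-- The weighted Sobolev inequality for fields with vanishing trace. -/
lemma exists_lintegral_norm_pow_div_le : ∃ C : ℝ≥0∞, C ≠ ⊤ ∧
    ∀ (v : Plane → Plane) (Dv : Plane → Mat22), IsD10 v Dv →
    ∫⁻ x : Plane, ENNReal.ofReal (‖v x‖ ^ 16 / x 1 ^ 2) ∂halfVol ≤
      C * eLpNorm Dv 2 halfVol ^ 16 := by
  -- `m = 7` gives the power `2 * (7 + 1) = 16`, whose fourth root is the power 4 needed in the
  -- theorem.
  obtain ⟨C, hC, h⟩ := exists_lintegral_pow_div_le_of_weakDeriv 7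
  refine ⟨2 ^ 8 * C * 2 ^ 16, by finiteness, fun v Dv hv => ?_⟩
  set N := eLpNorm Dv 2 halfVol with hN
  have hNtop : N ≠ ⊤ := hv.memLp_grad.eLpNorm_ne_top
  -- A free `t > 0` covers the case `N = 0`; at the end `t` decreases to `2 * N.toReal`, which is
  -- the source of the factor `2 ^ 16`.
  have hcomp : ∀ (i : Fin 2) (t : ℝ), 0 < t → 2 * N.toReal ≤ t →
      ∫⁻ x : Plane, ENNReal.ofReal (v x i ^ 16 / x 1 ^ 2) ∂halfVol ≤
        C * ENNReal.ofReal (t ^ 16) := by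
    intro i t ht htN
    have hvi : LocallyIntegrable (fun x => v x i) halfVol := fun x => by
      obtain ⟨s, hs, hfs⟩ := hv.trace_eq_zero.locInt x
      exact ⟨s, hs, (EuclideanSpace.proj i : Plane →L[ℝ] ℝ).integrable_comp hfs⟩
    have hDm : ∀ j, AEStronglyMeasurable (fun x => Dv x (i, j)) halfVol := fun j =>
      (EuclideanSpace.proj (i, j) : Mat22 →L[ℝ] ℝ).continuous.comp_aestronglyMeasurable
        hv.memLp_grad.aestronglyMeasurable
    have key := h (halfPlane.indicator fun x => v x i)
      (fun j => halfPlane.indicator fun x => Dv x (i, j)) t ht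
      (locallyIntegrable_indicator_halfPlane hvi)
      (fun j => (aestronglyMeasurable_indicator_iff measurableSet_halfPlane).2 (hDm j))
      (fun x hx => Set.indicator_of_notMem (by simpa [halfPlane] using hx) _) ?_ ?_
    · refine le_trans (le_of_eq (lintegral_congr_ae ?_)) key
      filter_upwards [ae_restrict_mem measurableSet_halfPlane] with x hx
      rw [Set.indicator_of_mem hx]
    · intro ψ hψ hψc j
      -- With zero boundary term, Green's formula says exactly that the extensions by zero of `v`
      -- and `Dv` satisfy the weak gradient identity on the whole plane.
      have hg := hv.trace_eq_zero.green ψ hψ hψc i j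
      simp only [Pi.zero_apply, PiLp.zero_apply, zero_mul, integral_zero] at hg
      simp_rw [← Set.indicator_mul_left]
      rw [integral_indicator measurableSet_halfPlane, integral_indicator measurableSet_halfPlane]
      exact eq_neg_of_add_eq_zero_left hg
    · have hj : ∀ j, ∫⁻ x, ENNReal.ofReal ((halfPlane.indicator fun x => Dv x (i, j)) x ^ 2) ≤
          N ^ 2 := fun j => by
        have hN2 : N ^ 2 = ∫⁻ x, ‖Dv x‖ₑ ^ 2 ∂halfVol := eLpNorm_pow_eq_lintegral Dv halfVol 2
        rw [hN2, halfVol, ← lintegral_indicator measurableSet_halfPlane]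
        refine lintegral_mono fun x => ?_
        by_cases hx : x ∈ halfPlane
        · simp only [Set.indicator_of_mem hx]
          rw [← ofReal_norm, ← ENNReal.ofReal_pow (norm_nonneg _), ← sq_abs]
          gcongr
          exact PiLp.norm_apply_le (Dv x) (i, j)
        · simp [Set.indicator_of_notMem hx]
      calc _ ≤ 2 * ∑ _j : Fin 2, N ^ 2 := by gcongr with j; exact hj j
        _ = (2 * N) ^ 2 := by rw [Fin.sum_univ_two, mul_pow]; ring
        _ = ENNReal.ofReal ((2 * N.toReal) ^ 2) := by
            rw [ENNReal.ofReal_pow (by positivity), ENNReal.ofReal_mul (by norm_num),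
              ENNReal.ofReal_toReal hNtop]
            norm_num
        _ ≤ _ := by gcongr
  have hmeas : ∀ i, AEMeasurable (fun x => v x i) halfVol := fun i =>
    ((EuclideanSpace.proj i : Plane →L[ℝ] ℝ).continuous.comp_aestronglyMeasurable
      hv.trace_eq_zero.locInt.aestronglyMeasurable).aemeasurable
  have hx1 : Measurable (fun x : Plane => x 1) :=
    (by fun_prop : Continuous fun x : Plane => x 1).measurable
  have hpt : ∀ x : Plane, ENNReal.ofReal (‖v x‖ ^ 16 / x 1 ^ 2) ≤
      2 ^ 7 * (ENNReal.ofReal (v x 0 ^ 16 / x 1 ^ 2) + ENNReal.ofReal (v x 1 ^ 16 / x 1 ^ 2)) := by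
    intro x
    have hnorm : ‖v x‖ ^ 16 ≤ 2 ^ 7 * (v x 0 ^ 16 + v x 1 ^ 16) := by
      have e1 : ‖v x‖ ^ 16 = (v x 0 ^ 2 + v x 1 ^ 2) ^ 8 := by
        have := EuclideanSpace.norm_sq_eq (v x)
        rw [Fin.sum_univ_two, Real.norm_eq_abs, Real.norm_eq_abs, sq_abs, sq_abs] at this
        rw [← this, ← pow_mul]
      rw [e1]
      refine (add_pow_le (sq_nonneg _) (sq_nonneg _) 8).trans (le_of_eq ?_)
      rw [← pow_mul, ← pow_mul]
    rw [← ENNReal.ofReal_add (by positivity) (by positivity)]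
    have e2 : (2 : ℝ≥0∞) ^ 7 = ENNReal.ofReal (2 ^ 7) := by
      rw [ENNReal.ofReal_pow (by norm_num)]; norm_num
    rw [e2, ← ENNReal.ofReal_mul (by positivity), ← add_div, ← mul_div_assoc]
    gcongr
  have hall : ∀ t : ℝ, 0 < t → 2 * N.toReal ≤ t →
      ∫⁻ x : Plane, ENNReal.ofReal (‖v x‖ ^ 16 / x 1 ^ 2) ∂halfVol ≤
        2 ^ 8 * C * ENNReal.ofReal (t ^ 16) := by
    intro t ht htN
    have hm0 : AEMeasurable (fun x : Plane => ENNReal.ofReal (v x 0 ^ 16 / x 1 ^ 2)) halfVol :=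
      (((hmeas 0).pow_const 16).div (hx1.pow_const 2).aemeasurable).ennreal_ofReal
    calc _ ≤ ∫⁻ x : Plane, 2 ^ 7 * (ENNReal.ofReal (v x 0 ^ 16 / x 1 ^ 2) +
          ENNReal.ofReal (v x 1 ^ 16 / x 1 ^ 2)) ∂halfVol := lintegral_mono hpt
      _ = 2 ^ 7 * ((∫⁻ x : Plane, ENNReal.ofReal (v x 0 ^ 16 / x 1 ^ 2) ∂halfVol) +
          ∫⁻ x : Plane, ENNReal.ofReal (v x 1 ^ 16 / x 1 ^ 2) ∂halfVol) := by
          rw [lintegral_const_mul' _ _ (by finiteness), lintegral_add_left' hm0]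
      _ ≤ 2 ^ 7 * (C * ENNReal.ofReal (t ^ 16) + C * ENNReal.ofReal (t ^ 16)) := by
          gcongr
          · exact hcomp 0 t ht htN
          · exact hcomp 1 t ht htN
      _ = _ := by ring
  have hlim : Tendsto (fun s : ℝ => 2 ^ 8 * C * ENNReal.ofReal ((2 * N.toReal + s) ^ 16)) (𝓝[>] 0)
      (𝓝 (2 ^ 8 * C * ENNReal.ofReal ((2 * N.toReal + 0) ^ 16))) := by
    refine ENNReal.Tendsto.const_mul (ENNReal.tendsto_ofReal ?_) (Or.inr (by finiteness))
    exact ((by fun_prop : Continuous fun s : ℝ => (2 * N.toReal + s) ^ 16).tendsto 0).mono_left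
      nhdsWithin_le_nhds
  have hfin := ge_of_tendsto hlim (b := ∫⁻ x : Plane, ENNReal.ofReal (‖v x‖ ^ 16 / x 1 ^ 2) ∂halfVol)
    (by
      filter_upwards [self_mem_nhdsWithin] with s hs
      have hs' : 0 < s := hs
      exact hall _ (by positivity) (by linarith))
  refine hfin.trans (le_of_eq ?_)
  rw [add_zero, mul_pow, ENNReal.ofReal_mul (by positivity), ENNReal.ofReal_pow (by norm_num),
    ENNReal.ofReal_pow ENNReal.toReal_nonneg, ENNReal.ofReal_toReal hNtop, ENNReal.ofReal_ofNat,
    ← mul_assoc]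

/-! ### Hölder's inequality and conclusion. -/

lemma one_le_xbar (x : Plane) : 1 ≤ xbar x ∧ ‖x‖ ≤ xbar x := by
  have h1 : (1 : ℝ) ≤ Real.exp 1 := Real.one_le_exp zero_le_one
  have hx := sq_nonneg ‖x‖
  have hlog : 1 ≤ Real.log (Real.exp 1 + ‖x‖ ^ 2) := by
    rw [Real.le_log_iff_exp_le (by positivity)]; linarith
  have hlog2 : 1 ≤ Real.log (Real.exp 1 + ‖x‖ ^ 2) ^ 2 := one_le_pow₀ hlog
  have hs : Real.sqrt (Real.exp 1 + ‖x‖ ^ 2) ≤ xbar x :=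
    le_mul_of_one_le_right (Real.sqrt_nonneg _) hlog2
  refine ⟨le_trans ?_ hs, le_trans ?_ hs⟩
  · rw [Real.one_le_sqrt]; linarith
  · exact Real.le_sqrt_of_sq_le (by linarith)

/-- The right side equals `X ^ (α * a) * r ^ 4 * n ^ 4 / y ^ (1 / 2)`, and `X ^ (α * a)` dominates
`y ^ (1 / 2)` since `X ≥ 1` and `X ≥ y`. -/
lemma mul_pow_four_le_weighted {α ζ a b r n y X : ℝ} (ha : 0 ≤ a) (hb : 0 ≤ b) (hζ : 0 ≤ ζ)
    (hab : a + ζ * b = 4) (hαa : 1 / 2 ≤ α * a) (hr : 0 ≤ r) (hn : 0 ≤ n) (hy : 0 < y)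
    (hX : 1 ≤ X) (hyX : y ≤ X) :
    (r * n) ^ 4 ≤ (X ^ α * r) ^ a * (r ^ ζ) ^ b * (n ^ 16 / y ^ 2) ^ (1 / 4 : ℝ) := by
  have hX0 : 0 ≤ X := by linarith
  have e1 : (X ^ α * r) ^ a * (r ^ ζ) ^ b = X ^ (α * a) * r ^ 4 := by
    rw [Real.mul_rpow (by positivity) hr, ← Real.rpow_mul hX0, ← Real.rpow_mul hr, mul_assoc,
      ← Real.rpow_add_of_nonneg hr ha (mul_nonneg hζ hb), hab]
    norm_cast
  have e2 : (n ^ 16 / y ^ 2) ^ (1 / 4 : ℝ) = n ^ 4 / y ^ (1 / 2 : ℝ) := by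
    rw [Real.div_rpow (by positivity) (by positivity), ← Real.rpow_natCast n 16,
      ← Real.rpow_natCast y 2, ← Real.rpow_mul hn, ← Real.rpow_mul hy.le,
      ← Real.rpow_natCast n 4]
    norm_num
  have e3 : y ^ (1 / 2 : ℝ) ≤ X ^ (α * a) :=
    (Real.rpow_le_rpow hy.le hyX (by norm_num)).trans (Real.rpow_le_rpow_of_exponent_le hX hαa)
  have hy' : 0 < y ^ (1 / 2 : ℝ) := by positivity
  rw [e1, e2, mul_pow, mul_div_assoc', le_div_iff₀ hy']
  calc r ^ 4 * n ^ 4 * y ^ (1 / 2 : ℝ) ≤ r ^ 4 * n ^ 4 * X ^ (α * a) := by gcongr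
    _ = _ := by ring

lemma ennreal_rpow_le_one_add {a : ℝ} (ha0 : 0 ≤ a) (ha1 : a ≤ 1) (x : ℝ≥0∞) : x ^ a ≤ 1 + x := by
  rcases le_total x 1 with h | h
  · exact (ENNReal.rpow_le_one h ha0).trans le_self_add
  · calc x ^ a ≤ x ^ (1 : ℝ) := ENNReal.rpow_le_rpow_of_exponent_le h ha1
      _ = x := ENNReal.rpow_one x
      _ ≤ _ := le_add_self

/-- Hölder's inequality with three factors. -/
lemma lintegral_mul_mul_rpow_le {μ : Measure Plane} {f g h : Plane → ℝ≥0∞} (hf : AEMeasurable f μ)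
    (hg : AEMeasurable g μ) (hh : AEMeasurable h μ) {a b c : ℝ} (ha : 0 ≤ a) (hb : 0 ≤ b)
    (hc : 0 ≤ c) (habc : a + b + c = 1) :
    ∫⁻ x, f x ^ a * g x ^ b * h x ^ c ∂μ ≤
      (∫⁻ x, f x ∂μ) ^ a * (∫⁻ x, g x ∂μ) ^ b * (∫⁻ x, h x ∂μ) ^ c := by
  have := ENNReal.lintegral_prod_norm_pow_le (μ := μ) Finset.univ (f := ![f, g, h])
    (p := ![a, b, c]) (by intro i _; fin_cases i <;> assumption)
    (by simpa [Fin.sum_univ_three] using habc) (by intro i _; fin_cases i <;> assumption)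
  simpa [Fin.prod_univ_three] using this

theorem lemma2p4 (M₁ M₂ M₃ : ℝ) (hM₁ : 0 < M₁) (hM₂ : 0 < M₂) (hM₃ : 0 < M₃) :
    ∃ C : ℝ, 0 < C ∧
      ∀ (α ζ : ℝ), 1 < α → ζ = 4 * (2 * α + 1) / (α - 1) →
      ∀ (η : ℝ), 1 ≤ η →
      ∀ (ϱ : Plane → ℝ), (∀ᵐ x ∂halfVol, 0 ≤ ϱ x) →
        MemLp ϱ 1 halfVol → MemLp ϱ (ENNReal.ofReal ζ) halfVol →
        M₂ ≤ ∫ x in halfBall η, ϱ x →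
        eLpNorm ϱ 1 halfVol = ENNReal.ofReal M₁ →
        eLpNorm ϱ (ENNReal.ofReal ζ) halfVol ≤ ENNReal.ofReal M₃ →
        MemLp (fun x => xbar x ^ α * ϱ x) 1 halfVol →
      ∀ (v : Plane → Plane) (Dv : Plane → Mat22), IsD10 v Dv →
        MemLp (fun x => Real.sqrt (ϱ x) • v x) 2 halfVol →
        eLpNorm (fun x => ϱ x • v x) 4 halfVol ^ 4 ≤
          ENNReal.ofReal (C * η ^ 8)
            * (1 + eLpNorm (fun x => xbar x ^ α * ϱ x) 1 halfVol)
            * (eLpNorm (fun x => Real.sqrt (ϱ x) • v x) 2 halfVol ^ 4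
              + eLpNorm Dv 2 halfVol ^ 4) := by
  obtain ⟨C₀, hC₀, hsob⟩ := exists_lintegral_norm_pow_div_le
  have hC₁ : C₀ ^ (1 / 4 : ℝ) ≠ ⊤ := ENNReal.rpow_ne_top_of_nonneg (by norm_num) hC₀
  refine ⟨(C₀ ^ (1 / 4 : ℝ)).toReal * max 1 M₃ ^ 4 + 1, by positivity, ?_⟩
  intro α ζ hα hζ η hη ϱ hϱ0 hϱ1 _ _ _ hM hw v Dv hv _
  have hα1 : 0 < α - 1 := by linarith
  have hζ0 : 0 < ζ := by rw [hζ]; positivity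
  -- `a` and `b` solve `a + b = 3 / 4` and `a + ζ * b = 4`, where `ζ - 1 = (7 * α + 5) / (α - 1)`.
  set a : ℝ := (2 * α + 7) / (7 * α + 5) with ha
  set b : ℝ := 13 * (α - 1) / (4 * (7 * α + 5)) with hb
  have ha0 : 0 ≤ a := by positivity
  have hb0 : 0 ≤ b := by positivity
  have hd : (0 : ℝ) < 7 * α + 5 := by linarith
  have ha1 : a ≤ 1 := by rw [ha, div_le_one hd]; linarith
  have hab : a + ζ * b = 4 := by rw [ha, hb, hζ]; field_simp; ring
  have habc : a + b + 1 / 4 = 1 := by rw [ha, hb]; field_simp; ring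
  have hαa : 1 / 2 ≤ α * a := by
    rw [ha, mul_div_assoc', div_le_div_iff₀ (by norm_num) hd]; nlinarith
  set F : Plane → ℝ≥0∞ := fun x => ‖xbar x ^ α * ϱ x‖ₑ with hF
  set G : Plane → ℝ≥0∞ := fun x => ‖ϱ x‖ₑ ^ ζ with hG
  set H : Plane → ℝ≥0∞ := fun x => ENNReal.ofReal (‖v x‖ ^ 16 / x 1 ^ 2) with hH
  have hx1 : Measurable (fun x : Plane => x 1) :=
    (by fun_prop : Continuous fun x : Plane => x 1).measurable
  have hFm : AEMeasurable F halfVol := hw.aestronglyMeasurable.enorm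
  have hGm : AEMeasurable G halfVol := hϱ1.aestronglyMeasurable.enorm.pow_const ζ
  have hHm : AEMeasurable H halfVol :=
    ((hv.trace_eq_zero.locInt.aestronglyMeasurable.norm.aemeasurable.pow_const 16).div
      (hx1.pow_const 2).aemeasurable).ennreal_ofReal
  have hpt : ∀ᵐ x ∂halfVol, ‖ϱ x • v x‖ₑ ^ 4 ≤ F x ^ a * G x ^ b * H x ^ (1 / 4 : ℝ) := by
    filter_upwards [hϱ0, ae_restrict_mem measurableSet_halfPlane] with x hx hx0
    have hy : 0 < x 1 := hx0
    obtain ⟨hX1, hX2⟩ := one_le_xbar x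
    have hX0 : 0 ≤ xbar x := by linarith
    have key := mul_pow_four_le_weighted ha0 hb0 hζ0.le hab hαa hx (norm_nonneg (v x)) hy hX1
      (((le_abs_self _).trans (abs_coord_le_norm x 1)).trans hX2)
    have eF : F x ^ a = ENNReal.ofReal ((xbar x ^ α * ϱ x) ^ a) := by
      simp only [hF]
      rw [Real.enorm_of_nonneg (by positivity), ENNReal.ofReal_rpow_of_nonneg (by positivity) ha0]
    have eG : G x ^ b = ENNReal.ofReal ((ϱ x ^ ζ) ^ b) := by
      simp only [hG]
      rw [Real.enorm_of_nonneg hx, ENNReal.ofReal_rpow_of_nonneg hx hζ0.le,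
        ENNReal.ofReal_rpow_of_nonneg (by positivity) hb0]
    have eH : H x ^ (1 / 4 : ℝ) = ENNReal.ofReal ((‖v x‖ ^ 16 / x 1 ^ 2) ^ (1 / 4 : ℝ)) := by
      rw [hH, ENNReal.ofReal_rpow_of_nonneg (by positivity) (by norm_num)]
    rw [eF, eG, eH, ← ENNReal.ofReal_mul (by positivity), ← ENNReal.ofReal_mul (by positivity),
      ← ofReal_norm, ← ENNReal.ofReal_pow (norm_nonneg _), norm_smul, Real.norm_of_nonneg hx]
    exact ENNReal.ofReal_le_ofReal key
  -- The exponent `ζ * b = 4 - a` depends on `α` but is at most 4; replacing `M₃` by `max 1 M₃`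
  -- makes the bound uniform in `α`.
  have hGi : (∫⁻ x, G x ∂halfVol) ^ b ≤ ENNReal.ofReal (max 1 M₃ ^ 4) := by
    have e : ∫⁻ x, G x ∂halfVol = eLpNorm ϱ (ENNReal.ofReal ζ) halfVol ^ ζ := by
      have hζ' : ζ.toNNReal ≠ 0 := by simpa using hζ0
      have := eLpNorm_nnreal_pow_eq_lintegral (f := ϱ) (μ := halfVol) hζ'
      rw [Real.coe_toNNReal ζ hζ0.le] at this
      exact this.symm
    rw [e, ← ENNReal.rpow_mul]
    calc _ ≤ ENNReal.ofReal (max 1 M₃) ^ (ζ * b) := by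
          refine ENNReal.rpow_le_rpow (hM.trans ?_) (by positivity)
          exact ENNReal.ofReal_le_ofReal (le_max_right _ _)
      _ ≤ ENNReal.ofReal (max 1 M₃) ^ (4 : ℝ) := by
          refine ENNReal.rpow_le_rpow_of_exponent_le ?_ (by linarith)
          simp
      _ = _ := by
          rw [ENNReal.ofReal_rpow_of_nonneg (by positivity) (by norm_num)]
          norm_cast
  have hHi : (∫⁻ x, H x ∂halfVol) ^ (1 / 4 : ℝ) ≤
      C₀ ^ (1 / 4 : ℝ) * eLpNorm Dv 2 halfVol ^ 4 := by
    refine (ENNReal.rpow_le_rpow (hsob v Dv hv) (by norm_num)).trans (le_of_eq ?_)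
    rw [ENNReal.mul_rpow_of_nonneg _ _ (by norm_num), ← ENNReal.rpow_natCast _ 16,
      ← ENNReal.rpow_mul, ← ENNReal.rpow_natCast _ 4]
    norm_num
  have hFi : (∫⁻ x, F x ∂halfVol) ^ a ≤
      1 + eLpNorm (fun x => xbar x ^ α * ϱ x) 1 halfVol := by
    rw [eLpNorm_one_eq_lintegral_enorm]
    exact ennreal_rpow_le_one_add ha0 ha1 _
  calc eLpNorm (fun x => ϱ x • v x) 4 halfVol ^ 4
      = ∫⁻ x, ‖ϱ x • v x‖ₑ ^ 4 ∂halfVol := eLpNorm_pow_eq_lintegral _ _ 4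
    _ ≤ ∫⁻ x, F x ^ a * G x ^ b * H x ^ (1 / 4 : ℝ) ∂halfVol := lintegral_mono_ae hpt
    _ ≤ _ := lintegral_mul_mul_rpow_le hFm hGm hHm ha0 hb0 (by norm_num) habc
    _ ≤ (1 + eLpNorm (fun x => xbar x ^ α * ϱ x) 1 halfVol) * ENNReal.ofReal (max 1 M₃ ^ 4) *
        (C₀ ^ (1 / 4 : ℝ) * eLpNorm Dv 2 halfVol ^ 4) := by gcongr
    _ = ENNReal.ofReal ((C₀ ^ (1 / 4 : ℝ)).toReal * max 1 M₃ ^ 4) *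
        (1 + eLpNorm (fun x => xbar x ^ α * ϱ x) 1 halfVol) * eLpNorm Dv 2 halfVol ^ 4 := by
        rw [ENNReal.ofReal_mul ENNReal.toReal_nonneg, ENNReal.ofReal_toReal hC₁]
        ring
    _ ≤ _ := by
        have hC : (C₀ ^ (1 / 4 : ℝ)).toReal * max 1 M₃ ^ 4 ≤
            ((C₀ ^ (1 / 4 : ℝ)).toReal * max 1 M₃ ^ 4 + 1) * η ^ 8 :=
          (le_add_of_nonneg_right zero_le_one).trans
            (le_mul_of_one_le_right (by positivity) (one_le_pow₀ hη))
        exact mul_le_mul' (mul_le_mul' (ENNReal.ofReal_le_ofReal hC) le_rfl) le_add_self
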